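/- For every sample size $n\ge 1$ let $p=p(n)$ be a dimension, $\gamma_n=p/n$, let $\Pi=\Pi_n$ be a real $p\times p$ orthogonal projection matrix ($\Pi^\top=\Pi$, $\Pi^2=\Pi$) with $\operatorname{rank}(\Pi_n)=o(p)$ as $n\to\infty$, and put $U_n=I_p-2\Pi_n$ (an orthogonal matrix). Let $\Lambda_n=\operatorname{diag}(\lambda_1,\dots,\lambda_p)$ be any diagonal matrices with non-negative entries that are bounded by a constant not depending on $n$, for all large $n$, and let $\Sigma_n=U_n\Lambda_nU_n^\top$. Then $\Sigma_n$ satisfies the following eigenvector regularity condition. Let $H_n=p^{-1}\sum_{j=1}^p\delta_{\lambda_j}$ be the spectral distribution of $\Sigma_n$, and let $t_n(z)$ be the Stieltjes transform $\int (x-z)^{-1}\,dF(x)$ of $F=\mathcal F(H_n,\gamma_n)$, where $\mathcal F(H,\gamma)$ is the Marčenko–Pastur law: the unique probability measure on $\mathbb R$ whose Stieltjes transform $t$ satisfies, for all $z$ with $\Im z>0$, $$t(z)=\int\frac{dH(x)}{x\{1-\gamma-\gamma z\,t(z)\}-z}\qquad\text{and}\qquad \Im\Big\{-\frac{1-\gamma}{z}+\gamma\,t(z)\Big\}>0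 .$$ Let $\Sigma_n=V_nD_nV_n^\top$ be any spectral decomposition of $\Sigma_n$ ($V_n$ orthogonal, $D_n$ diagonal), in particular $V_n=U_n$, $D_n=\Lambda_n$. Then for $z\in\mathbb C\setminus\mathbb R$ the matrix $-zI_p+\{(1-\gamma_n)-z\gamma_nt_n(z)\}D_n$ is invertible, and with $$\Gamma_{n,\ell}(z)=D_n^{1/2}\Big[-zI_p+\{(1-\gamma_n)-z\gamma_nt_n(z)\}D_n\Big]^{-\ell}D_n^{1/2},\qquad \ell\in\{1,2\},$$ we have, for all fixed $z_1,z_2\in\mathbb C\setminus\mathbb R$ and each $\ell\in\{1,2\}$, as $n\to\infty$, $$\frac1p\sum_{j=1}^p\{V_n\Gamma_{n,\ell}(z_1)V_n^\top\}_{jj}\{V_n\Gamma_{n,2}(z_2)V_n^\top\}_{jj}=\frac1p\sum_{j=1}^p\{\Gamma_{n,\ell}(z_1)\}_{jj}\{\Gamma_{n,2}(z_2)\}_{jj}+o(1).$$ -/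

import Mathlib

open scoped Matrix

noncomputable section

/-- The Stieltjes transform `z ↦ ∫ 1 / (x - z) dF(x)` of a measure `F` on `ℝ`
(used for `z` off the real axis). -/
def stieltjes (F : MeasureTheory.Measure ℝ) (z : ℂ) : ℂ :=
  ∫ x : ℝ, 1 / ((x : ℂ) - z) ∂F

/-- `F` is the (generalized) Marčenko–Pastur law with population spectral distribution `H` and
aspect ratio `γ`: the probability measure on `ℝ` whose Stieltjes transform `t` solves, at every
`z` in the upper half plane, the Marčenko–Pastur equation
`t = ∫ 1 / (x (1 - γ - γ z t) - z) dH(x)`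
in the region where `-(1 - γ) / z + γ t` lies in the upper half plane. For a probability measure
`H` on `[0, ∞)` and `γ > 0` it is classical that there is exactly one such `F`, and that it is the
almost sure weak limit of the spectral distributions of sample covariance matrices of i.i.d. type
with population spectral distributions converging to `H` and dimension / sample size → `γ`. -/
structure IsMarchenkoPasturLaw (H : MeasureTheory.Measure ℝ) (γ : ℝ)
    (F : MeasureTheory.Measure ℝ) : Prop where
  isProbabilityMeasure : MeasureTheory.IsProbabilityMeasure F
  equation : ∀ z : ℂ, 0 < z.im →
    stieltjes F z = ∫ x : ℝ, 1 / ((x : ℂ) * (1 - γ - γ * z * stieltjes F z) - z) ∂H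
  companion : ∀ z : ℂ, 0 < z.im → 0 < (-(1 - (γ : ℂ)) / z + γ * stieltjes F z).im

open scoped Classical in
/-- The Marčenko–Pastur map `(H, γ) ↦ 𝓕(H, γ)` (with value `0` where no such law exists, which
does not happen for a probability measure `H` on `[0, ∞)` and `γ > 0`). -/
def marchenkoPasturMap (H : MeasureTheory.Measure ℝ) (γ : ℝ) : MeasureTheory.Measure ℝ :=
  if h : ∃ F, IsMarchenkoPasturLaw H γ F then h.choose else 0

/-- The distribution `p⁻¹ ∑ⱼ δ_{λⱼ}` of a family of `p` eigenvalues. -/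
def spectralDistribution {p : ℕ} (lam : Fin p → ℝ) : MeasureTheory.Measure ℝ :=
  (p : ENNReal)⁻¹ • ∑ j, MeasureTheory.Measure.dirac (lam j)

/-- `t_n(z)`: the Stieltjes transform of `𝓕(H_n, γ_n)`, where `H_n` is the distribution of the
eigenvalues `lam` and `γ_n = p / n`. -/
def mpStieltjes (n : ℕ) {p : ℕ} (lam : Fin p → ℝ) (z : ℂ) : ℂ :=
  stieltjes (marchenkoPasturMap (spectralDistribution lam) ((p : ℝ) / n)) z

/-- The middle factor `-z I_p + {(1 - γ_n) - z γ_n t_n(z)} Λ_n`, with `Λ_n = diag(lam)`. -/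
def middleFactor (n : ℕ) {p : ℕ} (lam : Fin p → ℝ) (z : ℂ) : Matrix (Fin p) (Fin p) ℂ :=
  (-z) • (1 : Matrix (Fin p) (Fin p) ℂ) +
    ((1 - (p : ℂ) / n) - z * ((p : ℂ) / n) * mpStieltjes n lam z) •
      Matrix.diagonal (fun j => (lam j : ℂ))

/-- `Γ_{n,ℓ}(z) = Λ_n^{1/2} [-z I_p + {(1 - γ_n) - z γ_n t_n(z)} Λ_n]^{-ℓ} Λ_n^{1/2}`. -/
def gammaMatrix (n : ℕ) {p : ℕ} (lam : Fin p → ℝ) (l : ℕ) (z : ℂ) :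
    Matrix (Fin p) (Fin p) ℂ :=
  Matrix.diagonal (fun j => ((√(lam j) : ℝ) : ℂ)) * ((middleFactor n lam z)⁻¹) ^ l *
    Matrix.diagonal (fun j => ((√(lam j) : ℝ) : ℂ))

/-- `S = U diag(lam) Uᵀ` with `U` orthogonal. -/
def IsSpectralDecomposition {p : ℕ} (S U : Matrix (Fin p) (Fin p) ℝ) (lam : Fin p → ℝ) : Prop :=
  U ∈ Matrix.orthogonalGroup (Fin p) ℝ ∧ S = U * Matrix.diagonal lam * Uᵀ

/-- The average `p⁻¹ ∑ⱼ A_{jj} B_{jj}`. -/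
def diagAverage {p : ℕ} (A B : Matrix (Fin p) (Fin p) ℂ) : ℂ :=
  (p : ℂ)⁻¹ * ∑ j, A j j * B j j

/-- The conjugate `U A Uᵀ` of a complex matrix by a real one. -/
def conjBy {p : ℕ} (U : Matrix (Fin p) (Fin p) ℝ) (A : Matrix (Fin p) (Fin p) ℂ) :
    Matrix (Fin p) (Fin p) ℂ :=
  U.map (fun x : ℝ => (x : ℂ)) * A * (U.map (fun x : ℝ => (x : ℂ)))ᵀ

/-- Regularity of the eigenvectors of a sequence of covariance matrices `S n` of size `p n`,
for sample sizes `n → ∞`: for every spectral decomposition `S n = U n diag(lam n) (U n)ᵀ`,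
the middle factors are invertible, so that the matrices `Γ_{n,ℓ}(z)` are well defined, and
`p⁻¹ ∑ⱼ {U Γ_{n,ℓ}(z₁) Uᵀ}ⱼⱼ {U Γ_{n,2}(z₂) Uᵀ}ⱼⱼ = p⁻¹ ∑ⱼ {Γ_{n,ℓ}(z₁)}ⱼⱼ {Γ_{n,2}(z₂)}ⱼⱼ + o(1)`
for all non-real `z₁, z₂` and `ℓ ∈ {1, 2}`. -/
def EigenvectorRegularity (p : ℕ → ℕ) (S : ∀ n, Matrix (Fin (p n)) (Fin (p n)) ℝ) : Prop :=
  ∀ (U : ∀ n, Matrix (Fin (p n)) (Fin (p n)) ℝ) (lam : ∀ n, Fin (p n) → ℝ),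
    (∀ n, IsSpectralDecomposition (S n) (U n) (lam n)) →
    (∀ n, ∀ z : ℂ, z.im ≠ 0 → IsUnit (middleFactor n (lam n) z)) ∧
    ∀ z₁ z₂ : ℂ, z₁.im ≠ 0 → z₂.im ≠ 0 → ∀ l : ℕ, l = 1 ∨ l = 2 →
      Filter.Tendsto
        (fun n =>
          diagAverage (conjBy (U n) (gammaMatrix n (lam n) l z₁))
              (conjBy (U n) (gammaMatrix n (lam n) 2 z₂)) -
            diagAverage (gammaMatrix n (lam n) l z₁) (gammaMatrix n (lam n) 2 z₂))
        Filter.atTop (nhds 0)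

end

/-!
Two observations give the result. First, the companion transform `m` of a Marčenko–Pastur law
satisfies `-1 / m = z - γ ∫ x / (1 + x m) dH(x)`, and the integrand has non-positive imaginary
part, so `Im (-1 / m) ≥ Im z`. Hence `x (1 - γ - γ z t) - z = -z (1 + x m)` stays away from zero
uniformly in `H`, `γ` and `x ∈ [-C, C]`, and the diagonal entries of `Γ_{n,ℓ}(z)` are bounded
uniformly in `n`.

Second, `(U diag(a) Uᵀ)ⱼⱼ = ∑ₖ Uⱼₖ² aₖ` is an average of the `aₖ` which gives `aⱼ` the weight
`Uⱼⱼ²`, so the two sides of the regularity condition differ by at most a constant times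
`p⁻¹ ∑ⱼ (1 - Uⱼⱼ²)`. For `U = 1 - 2 Π` the latter is at most `4 tr Π / p = 4 rank Π / p`.
-/

open MeasureTheory Filter

section CompanionTransform

theorem im_le_norm_mul_norm_one_add_ofReal_mul (m : ℂ) (x : ℝ) :
    m.im ≤ ‖m‖ * ‖1 + (x : ℂ) * m‖ := by
  have him : (m + x * (m * (starRingEnd ℂ) m)).im = m.im := by
    rw [Complex.mul_conj, ← Complex.ofReal_mul, Complex.add_im, Complex.ofReal_im, add_zero]
  calc m.im = (m + x * (m * (starRingEnd ℂ) m)).im := him.symm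
    _ ≤ ‖m + x * (m * (starRingEnd ℂ) m)‖ := Complex.im_le_norm _
    _ = ‖m * (starRingEnd ℂ) (1 + x * m)‖ := by
      rw [map_add, map_mul, map_one, Complex.conj_ofReal]
      ring_nf
    _ = ‖m‖ * ‖1 + (x : ℂ) * m‖ := by rw [norm_mul, Complex.norm_conj]

theorem one_add_ofReal_mul_ne_zero {m : ℂ} (hm : 0 < m.im) (x : ℝ) : 1 + (x : ℂ) * m ≠ 0 := by
  intro h
  have := im_le_norm_mul_norm_one_add_ofReal_mul m x
  rw [h, norm_zero, mul_zero] at this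
  exact this.not_gt hm

theorem im_div_one_add_ofReal_mul_nonpos {m : ℂ} (hm : 0 ≤ m.im) (x : ℝ) :
    ((x : ℂ) / (1 + x * m)).im ≤ 0 := by
  have him : ((x : ℂ) / (1 + x * m)).im = -(x ^ 2 * m.im / Complex.normSq (1 + x * m)) := by
    rw [Complex.div_im]
    simp only [Complex.ofReal_im, Complex.ofReal_re, Complex.add_im, Complex.one_im,
      Complex.im_ofReal_mul]
    ring
  rw [him, neg_nonpos]
  exact div_nonneg (by positivity) (Complex.normSq_nonneg _)

theorem integrable_one_div_one_add_ofReal_mul (H : Measure ℝ) [IsFiniteMeasure H] {m : ℂ}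
    (hm : 0 < m.im) : Integrable (fun x : ℝ => 1 / (1 + (x : ℂ) * m)) H := by
  have hmeas : Measurable fun x : ℝ => 1 / (1 + (x : ℂ) * m) := by fun_prop
  refine .of_bound hmeas.aestronglyMeasurable (‖m‖ / m.im) (ae_of_all _ fun x => ?_)
  have hpos : 0 < ‖1 + (x : ℂ) * m‖ := norm_pos_iff.mpr (one_add_ofReal_mul_ne_zero hm x)
  rw [norm_div, norm_one, div_le_div_iff₀ hpos hm, one_mul]
  exact im_le_norm_mul_norm_one_add_ofReal_mul m x

theorem mul_div_one_add_ofReal_mul {m : ℂ} (hm : 0 < m.im) (x : ℝ) :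
    m * ((x : ℂ) / (1 + x * m)) = 1 - 1 / (1 + (x : ℂ) * m) := by
  rw [mul_div_assoc', eq_sub_iff_add_eq, ← add_div, div_eq_one_iff_eq
    (one_add_ofReal_mul_ne_zero hm x)]
  ring

theorem integrable_div_one_add_ofReal_mul (H : Measure ℝ) [IsFiniteMeasure H] {m : ℂ}
    (hm : 0 < m.im) : Integrable (fun x : ℝ => (x : ℂ) / (1 + x * m)) H := by
  have hm0 : m ≠ 0 := by rintro rfl; exact hm.ne rfl
  refine (integrable_const_mul_iff (IsUnit.mk0 m hm0) _).mp ?_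
  simp_rw [mul_div_one_add_ofReal_mul hm]
  exact (integrable_const 1).sub (integrable_one_div_one_add_ofReal_mul H hm)

/-- The companion Stieltjes transform `m(z) = -(1 - γ) / z + γ t(z)`, where `t` is the Stieltjes
transform of `F`. Bounds on the denominators of the Marčenko–Pastur equation come from `-1 / m`. -/
noncomputable def companionStieltjes (F : Measure ℝ) (γ : ℝ) (z : ℂ) : ℂ :=
  -(1 - (γ : ℂ)) / z + γ * stieltjes F z

theorem mul_companionStieltjes (F : Measure ℝ) (γ : ℝ) {z : ℂ} (hz : z ≠ 0) :
    z * companionStieltjes F γ z = -(1 - γ - γ * z * stieltjes F z) := by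
  unfold companionStieltjes
  field_simp
  ring

namespace IsMarchenkoPasturLaw

variable {H F : Measure ℝ} {γ : ℝ} {z : ℂ}

theorem mul_stieltjes_eq (h : IsMarchenkoPasturLaw H γ F) (hz : 0 < z.im) :
    z * stieltjes F z = -∫ x : ℝ, 1 / (1 + (x : ℂ) * companionStieltjes F γ z) ∂H := by
  have hz0 : z ≠ 0 := by rintro rfl; exact hz.ne rfl
  rw [h.equation z hz, ← integral_const_mul, ← integral_neg]
  congr 1 with x
  have hfactor : (x : ℂ) * (1 - γ - γ * z * stieltjes F z) - z =
      -z * (1 + x * companionStieltjes F γ z) := by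
    linear_combination (x : ℂ) * mul_companionStieltjes F γ hz0
  rw [hfactor]
  field_simp

theorem neg_one_div_companionStieltjes [IsProbabilityMeasure H] (h : IsMarchenkoPasturLaw H γ F)
    (hz : 0 < z.im) :
    -1 / companionStieltjes F γ z =
      z - γ * ∫ x : ℝ, (x : ℂ) / (1 + x * companionStieltjes F γ z) ∂H := by
  have hz0 : z ≠ 0 := by rintro rfl; exact hz.ne rfl
  have hzm := mul_companionStieltjes F γ hz0
  have hzt := h.mul_stieltjes_eq hz
  have hm : 0 < (companionStieltjes F γ z).im := h.companion z hz
  set m := companionStieltjes F γ z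
  have hm0 : m ≠ 0 := by intro h0; simp [h0] at hm
  have hint : m * ∫ x : ℝ, (x : ℂ) / (1 + x * m) ∂H = 1 + z * stieltjes F z := by
    rw [hzt, ← integral_const_mul]
    simp_rw [mul_div_one_add_ofReal_mul hm]
    rw [integral_sub (integrable_const 1) (integrable_one_div_one_add_ofReal_mul H hm)]
    simp [sub_eq_add_neg]
  rw [div_eq_iff hm0]
  linear_combination γ * hint - hzm

theorem im_le_im_neg_one_div_companionStieltjes [IsProbabilityMeasure H]
    (h : IsMarchenkoPasturLaw H γ F) (hγ : 0 ≤ γ) (hz : 0 < z.im) :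
    z.im ≤ (-1 / companionStieltjes F γ z).im := by
  have hm : 0 < (companionStieltjes F γ z).im := h.companion z hz
  have him : (∫ x : ℝ, (x : ℂ) / (1 + x * companionStieltjes F γ z) ∂H).im ≤ 0 := by
    refine (integral_im (integrable_div_one_add_ofReal_mul H hm)).symm.trans_le ?_
    exact integral_nonpos fun x => im_div_one_add_ofReal_mul_nonpos hm.le x
  rw [h.neg_one_div_companionStieltjes hz, Complex.sub_im, Complex.im_ofReal_mul]
  linarith [mul_nonpos_of_nonneg_of_nonpos hγ him]

end IsMarchenkoPasturLaw

end CompanionTransform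

section Denominator

theorem stieltjes_conj (F : Measure ℝ) (z : ℂ) :
    stieltjes F ((starRingEnd ℂ) z) = (starRingEnd ℂ) (stieltjes F z) := by
  simp [stieltjes, ← integral_conj]

theorem isMarchenkoPasturLaw_marchenkoPasturMap_or_eq_zero (H : Measure ℝ) (γ : ℝ) :
    IsMarchenkoPasturLaw H γ (marchenkoPasturMap H γ) ∨ marchenkoPasturMap H γ = 0 := by
  unfold marchenkoPasturMap
  split_ifs with h
  · exact Or.inl h.choose_spec
  · exact Or.inr rfl

theorem norm_mul_le_add_mul_norm_sub_ofReal {w : ℂ} {v C x : ℝ} (hv : 0 ≤ v) (hw : v ≤ w.im)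
    (hx : |x| ≤ C) : ‖w‖ * v ≤ (C + v) * ‖w - x‖ := by
  have hdist : v ≤ ‖w - x‖ := calc
    v ≤ (w - x).im := by simpa using hw
    _ ≤ ‖w - x‖ := Complex.im_le_norm _
  have hnorm : ‖w‖ ≤ ‖w - x‖ + C := by
    have := norm_sub_norm_le w x
    rw [Complex.norm_real, Real.norm_eq_abs] at this
    linarith
  have hC : 0 ≤ C := (abs_nonneg x).trans hx
  calc ‖w‖ * v ≤ (‖w - x‖ + C) * v := by gcongr
    _ = C * v + v * ‖w - x‖ := by ring
    _ ≤ C * ‖w - x‖ + v * ‖w - x‖ := by gcongr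
    _ = (C + v) * ‖w - x‖ := by ring

/-- The denominator `x (1 - γ - γ z t(z)) - z` of the Marčenko–Pastur equation, with `t` the
Stieltjes transform of `𝓕(H, γ)`. At the eigenvalues `x = λⱼ` it gives the diagonal entries of
the middle factor. -/
noncomputable def mpDenominator (H : Measure ℝ) (γ : ℝ) (z : ℂ) (x : ℝ) : ℂ :=
  x * (1 - γ - γ * z * stieltjes (marchenkoPasturMap H γ) z) - z

theorem mpDenominator_conj (H : Measure ℝ) (γ : ℝ) (z : ℂ) (x : ℝ) :
    mpDenominator H γ ((starRingEnd ℂ) z) x = (starRingEnd ℂ) (mpDenominator H γ z x) := by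
  simp [mpDenominator, stieltjes_conj]

variable {H : Measure ℝ} {γ : ℝ} {z : ℂ} {C x : ℝ}

theorem IsMarchenkoPasturLaw.sq_im_div_le_norm [IsProbabilityMeasure H] {F : Measure ℝ}
    (h : IsMarchenkoPasturLaw H γ F) (hγ : 0 ≤ γ) (hz : 0 < z.im) (hx : |x| ≤ C) :
    z.im ^ 2 / (C + z.im) ≤ ‖(x : ℂ) * (1 - γ - γ * z * stieltjes F z) - z‖ := by
  have hz0 : z ≠ 0 := by rintro rfl; exact hz.ne rfl
  have hm : 0 < (companionStieltjes F γ z).im := h.companion z hz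
  have hw := h.im_le_im_neg_one_div_companionStieltjes hγ hz
  have hzm := mul_companionStieltjes F γ hz0
  set m := companionStieltjes F γ z
  set w := -1 / m with hwdef
  have hm0 : m ≠ 0 := by intro h0; simp [h0] at hm
  have hw0 : w ≠ 0 := div_ne_zero (by simp) hm0
  have hfactor : ((x : ℂ) * (1 - γ - γ * z * stieltjes F z) - z) * w = -z * (w - x) := by
    have hmw : m * w = -1 := by rw [hwdef]; field_simp
    linear_combination x * w * hzm - x * z * hmw
  have hC : 0 < C + z.im := add_pos_of_nonneg_of_pos ((abs_nonneg x).trans hx) hz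
  rw [div_le_iff₀ hC]
  refine le_of_mul_le_mul_right ?_ (norm_pos_iff.mpr hw0)
  calc z.im ^ 2 * ‖w‖ = z.im * (‖w‖ * z.im) := by ring
    _ ≤ ‖z‖ * ((C + z.im) * ‖w - x‖) :=
      mul_le_mul (Complex.im_le_norm z) (norm_mul_le_add_mul_norm_sub_ofReal hz.le hw hx)
        (by positivity) (norm_nonneg z)
    _ = ‖-z * (w - x)‖ * (C + z.im) := by rw [norm_mul, norm_neg]; ring
    _ = ‖(x : ℂ) * (1 - γ - γ * z * stieltjes F z) - z‖ * (C + z.im) * ‖w‖ := by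
      rw [← hfactor, norm_mul]; ring

theorem sq_im_div_le_norm_mpDenominator_of_im_pos [IsProbabilityMeasure H] (hγ : 0 ≤ γ)
    (hz : 0 < z.im) (hx : |x| ≤ C) : z.im ^ 2 / (C + z.im) ≤ ‖mpDenominator H γ z x‖ := by
  rcases isMarchenkoPasturLaw_marchenkoPasturMap_or_eq_zero H γ with h | h
  · exact h.sq_im_div_le_norm hγ hz hx
  -- For the junk value `0` of the map the denominator is `x (1 - γ) - z`.
  · have hC : 0 ≤ C := (abs_nonneg x).trans hx
    calc z.im ^ 2 / (C + z.im) ≤ z.im := by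
          rw [div_le_iff₀ (by positivity)]
          nlinarith
      _ = |(mpDenominator H γ z x).im| := by
          simp [mpDenominator, h, stieltjes, abs_of_pos hz]
      _ ≤ ‖mpDenominator H γ z x‖ := Complex.abs_im_le_norm _

theorem sq_im_div_le_norm_mpDenominator [IsProbabilityMeasure H] (hγ : 0 ≤ γ) (hz : z.im ≠ 0)
    (hx : |x| ≤ C) : z.im ^ 2 / (C + |z.im|) ≤ ‖mpDenominator H γ z x‖ := by
  rcases hz.lt_or_gt with hneg | hpos
  · have hconj : 0 < ((starRingEnd ℂ) z).im := by simpa using hneg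
    have := sq_im_div_le_norm_mpDenominator_of_im_pos (H := H) hγ hconj hx
    rw [mpDenominator_conj, Complex.norm_conj, Complex.conj_im, neg_sq] at this
    rwa [abs_of_neg hneg]
  · rw [abs_of_pos hpos]
    exact sq_im_div_le_norm_mpDenominator_of_im_pos hγ hpos hx

theorem mpDenominator_ne_zero [IsProbabilityMeasure H] (hγ : 0 ≤ γ) (hz : z.im ≠ 0) (x : ℝ) :
    mpDenominator H γ z x ≠ 0 := by
  have hbound := sq_im_div_le_norm_mpDenominator (H := H) hγ hz (le_refl |x|)
  exact norm_pos_iff.mp (lt_of_lt_of_le (by positivity) hbound)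

/-- The function `x ↦ x / (x (1 - γ - γ z t(z)) - z) ^ l` whose values at the eigenvalues are the
diagonal entries of `Γ_{n,l}(z)`. -/
noncomputable def gammaSymbol (H : Measure ℝ) (γ : ℝ) (l : ℕ) (z : ℂ) (x : ℝ) : ℂ :=
  x / mpDenominator H γ z x ^ l

theorem norm_gammaSymbol_le [IsProbabilityMeasure H] (hγ : 0 ≤ γ) (l : ℕ) (hz : z.im ≠ 0)
    (hx : |x| ≤ C) : ‖gammaSymbol H γ l z x‖ ≤ C / (z.im ^ 2 / (C + |z.im|)) ^ l := by
  have hC : 0 ≤ C := (abs_nonneg x).trans hx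
  rw [gammaSymbol, norm_div, norm_pow, Complex.norm_real, Real.norm_eq_abs]
  gcongr
  exact sq_im_div_le_norm_mpDenominator hγ hz hx

end Denominator

section GammaMatrix

variable (n : ℕ) {p : ℕ}

theorem isProbabilityMeasure_spectralDistribution (hp : p ≠ 0) (lam : Fin p → ℝ) :
    IsProbabilityMeasure (spectralDistribution lam) := by
  constructor
  simp [spectralDistribution, ENNReal.inv_mul_cancel, hp]

theorem middleFactor_eq_diagonal (lam : Fin p → ℝ) (z : ℂ) :
    middleFactor n lam z =
      Matrix.diagonal fun j => mpDenominator (spectralDistribution lam) (p / n) z (lam j) := by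
  rw [middleFactor, ← Matrix.diagonal_one, ← Matrix.diagonal_smul, ← Matrix.diagonal_smul,
    Matrix.diagonal_add]
  congr 1 with j
  simp only [mpDenominator, mpStieltjes, Pi.smul_apply, smul_eq_mul]
  push_cast
  ring

variable {n} {z : ℂ}

theorem mpDenominator_spectralDistribution_ne_zero (lam : Fin p → ℝ) (hz : z.im ≠ 0)
    (j : Fin p) : mpDenominator (spectralDistribution lam) (p / n) z (lam j) ≠ 0 := by
  have := isProbabilityMeasure_spectralDistribution j.pos.ne' lam
  exact mpDenominator_ne_zero (by positivity) hz _

theorem isUnit_middleFactor (lam : Fin p → ℝ) (hz : z.im ≠ 0) :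
    IsUnit (middleFactor n lam z) := by
  rw [middleFactor_eq_diagonal, Matrix.isUnit_diagonal, Pi.isUnit_iff]
  exact fun j => (mpDenominator_spectralDistribution_ne_zero lam hz j).isUnit

theorem inv_middleFactor (lam : Fin p → ℝ) (hz : z.im ≠ 0) :
    (middleFactor n lam z)⁻¹ = Matrix.diagonal fun j =>
      (mpDenominator (spectralDistribution lam) (p / n) z (lam j))⁻¹ := by
  refine Matrix.inv_eq_left_inv ?_
  rw [middleFactor_eq_diagonal, Matrix.diagonal_mul_diagonal, ← Matrix.diagonal_one]
  congr 1 with j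
  exact inv_mul_cancel₀ (mpDenominator_spectralDistribution_ne_zero lam hz j)

theorem gammaMatrix_eq_diagonal {lam : Fin p → ℝ} (hlam : ∀ j, 0 ≤ lam j) (l : ℕ)
    (hz : z.im ≠ 0) :
    gammaMatrix n lam l z =
      Matrix.diagonal (gammaSymbol (spectralDistribution lam) (p / n) l z ∘ lam) := by
  rw [gammaMatrix, inv_middleFactor lam hz, Matrix.diagonal_pow, Matrix.diagonal_mul_diagonal,
    Matrix.diagonal_mul_diagonal]
  congr 1 with j
  have hsqrt : ((√(lam j) : ℝ) : ℂ) * (√(lam j) : ℝ) = lam j := by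
    rw [← Complex.ofReal_mul, Real.mul_self_sqrt (hlam j)]
  rw [mul_right_comm, hsqrt, Pi.pow_apply, inv_pow]
  rfl

end GammaMatrix

section SpectralDecomposition

theorem mapMatrix_mem_orthogonalGroup {n R S : Type*} [Fintype n] [DecidableEq n] [CommRing R]
    [CommRing S] (φ : R →+* S) {U : Matrix n n R} (hU : U ∈ Matrix.orthogonalGroup n R) :
    φ.mapMatrix U ∈ Matrix.orthogonalGroup n S := by
  rw [Matrix.mem_orthogonalGroup_iff] at hU ⊢
  rw [RingHom.mapMatrix_apply, ← Matrix.transpose_map, ← Matrix.map_mul, hU, Matrix.map_one]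
  · exact φ.map_zero
  · exact φ.map_one

theorem map_mul_diagonal_comp_of_mul_diagonal_eq {m n R S : Type*} [Fintype m] [DecidableEq m]
    [Fintype n] [DecidableEq n] [CommRing R] [NoZeroDivisors R] [CommRing S] (φ : R →+* S)
    {W : Matrix m n R} {lam : n → R} {mu : m → R}
    (h : W * Matrix.diagonal lam = Matrix.diagonal mu * W) (f : R → S) :
    W.map φ * Matrix.diagonal (f ∘ lam) = Matrix.diagonal (f ∘ mu) * W.map φ := by
  ext i j
  have hij := congrFun₂ h i j
  rw [Matrix.mul_diagonal, Matrix.diagonal_mul, mul_comm] at hij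
  rw [Matrix.mul_diagonal, Matrix.diagonal_mul, Matrix.map_apply, mul_comm]
  rcases eq_or_ne (W i j) 0 with h0 | h0
  · rw [h0, map_zero, mul_zero, mul_zero]
  · rw [Function.comp_apply, Function.comp_apply, mul_right_cancel₀ h0 hij]

namespace IsSpectralDecomposition

variable {p : ℕ} {S U V : Matrix (Fin p) (Fin p) ℝ} {lam mu : Fin p → ℝ}

theorem mul_eq (h : IsSpectralDecomposition S U lam) : S * U = U * Matrix.diagonal lam := by
  rw [h.2, Matrix.mul_assoc, (Matrix.mem_orthogonalGroup_iff' _ _).mp h.1, Matrix.mul_one]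

theorem transpose_mul_eq (h : IsSpectralDecomposition S U lam) :
    Uᵀ * S = Matrix.diagonal lam * Uᵀ := by
  rw [h.2, ← Matrix.mul_assoc, ← Matrix.mul_assoc, (Matrix.mem_orthogonalGroup_iff' _ _).mp h.1,
    Matrix.one_mul]

theorem roots_charpoly_eq (h : IsSpectralDecomposition S U lam) :
    S.charpoly.roots = Finset.univ.val.map lam := by
  have hcharpoly : S.charpoly = (Matrix.diagonal lam).charpoly := by
    rw [h.2, Matrix.mul_assoc, Matrix.charpoly_mul_comm, Matrix.mul_assoc,
      (Matrix.mem_orthogonalGroup_iff' _ _).mp h.1, Matrix.mul_one]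
  rw [hcharpoly, Matrix.charpoly_diagonal, ← Polynomial.roots_multiset_prod_X_sub_C
    (Finset.univ.val.map lam), Multiset.map_map]
  rfl

theorem map_eigenvalues_eq (hU : IsSpectralDecomposition S U lam)
    (hV : IsSpectralDecomposition S V mu) :
    Finset.univ.val.map lam = Finset.univ.val.map mu :=
  hU.roots_charpoly_eq.symm.trans hV.roots_charpoly_eq

theorem exists_eigenvalue_eq (hU : IsSpectralDecomposition S U lam)
    (hV : IsSpectralDecomposition S V mu) (j : Fin p) : ∃ i, mu i = lam j := by
  have hmem : lam j ∈ Finset.univ.val.map lam := Multiset.mem_map_of_mem lam (Finset.mem_univ j)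
  rw [hU.map_eigenvalues_eq hV, Multiset.mem_map] at hmem
  obtain ⟨i, -, hi⟩ := hmem
  exact ⟨i, hi⟩

theorem sum_comp_eq {M : Type*} [AddCommMonoid M] (hU : IsSpectralDecomposition S U lam)
    (hV : IsSpectralDecomposition S V mu) (f : ℝ → M) : ∑ j, f (lam j) = ∑ j, f (mu j) := by
  have h := congrArg (fun s => (s.map f).sum) (hU.map_eigenvalues_eq hV)
  simp only [Multiset.map_map] at h
  exact h

theorem conjBy_diagonal_comp_eq (hU : IsSpectralDecomposition S U lam)
    (hV : IsSpectralDecomposition S V mu) (f : ℝ → ℂ) :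
    conjBy U (Matrix.diagonal (f ∘ lam)) = conjBy V (Matrix.diagonal (f ∘ mu)) := by
  have hreal : Vᵀ * U * Matrix.diagonal lam = Matrix.diagonal mu * (Vᵀ * U) := by
    rw [Matrix.mul_assoc, ← hU.mul_eq, ← Matrix.mul_assoc, hV.transpose_mul_eq, Matrix.mul_assoc]
  have hcomplex := map_mul_diagonal_comp_of_mul_diagonal_eq Complex.ofRealHom hreal f
  rw [Matrix.map_mul, Matrix.transpose_map] at hcomplex
  have hu := (Matrix.mem_orthogonalGroup_iff _ _).mp
    (mapMatrix_mem_orthogonalGroup Complex.ofRealHom hU.1)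
  have hv := (Matrix.mem_orthogonalGroup_iff _ _).mp
    (mapMatrix_mem_orthogonalGroup Complex.ofRealHom hV.1)
  change U.map Complex.ofRealHom * _ * (U.map Complex.ofRealHom)ᵀ =
    V.map Complex.ofRealHom * _ * (V.map Complex.ofRealHom)ᵀ
  rw [RingHom.mapMatrix_apply] at hu hv
  set u := U.map Complex.ofRealHom
  set v := V.map Complex.ofRealHom
  calc u * Matrix.diagonal (f ∘ lam) * uᵀ
      = v * (vᵀ * u * Matrix.diagonal (f ∘ lam)) * uᵀ := by
        rw [← Matrix.mul_assoc, ← Matrix.mul_assoc, hv, Matrix.one_mul]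
    _ = v * Matrix.diagonal (f ∘ mu) * vᵀ * (u * uᵀ) := by
        rw [hcomplex]
        simp only [Matrix.mul_assoc]
    _ = v * Matrix.diagonal (f ∘ mu) * vᵀ := by rw [hu, Matrix.mul_one]

end IsSpectralDecomposition

end SpectralDecomposition

section DiagonalDefect

variable {p : ℕ}

/-- The error `p⁻¹ ∑ⱼ (U A Uᵀ)ⱼⱼ (U B Uᵀ)ⱼⱼ - p⁻¹ ∑ⱼ Aⱼⱼ Bⱼⱼ` which eigenvector regularity requires
to vanish asymptotically. -/
noncomputable def diagDefect (U : Matrix (Fin p) (Fin p) ℝ) (A B : Matrix (Fin p) (Fin p) ℂ) : ℂ :=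
  diagAverage (conjBy U A) (conjBy U B) - diagAverage A B

theorem IsSpectralDecomposition.diagDefect_diagonal_comp_eq {S U V : Matrix (Fin p) (Fin p) ℝ}
    {lam mu : Fin p → ℝ} (hU : IsSpectralDecomposition S U lam)
    (hV : IsSpectralDecomposition S V mu) (f g : ℝ → ℂ) :
    diagDefect U (Matrix.diagonal (f ∘ lam)) (Matrix.diagonal (g ∘ lam)) =
      diagDefect V (Matrix.diagonal (f ∘ mu)) (Matrix.diagonal (g ∘ mu)) := by
  have hsum := hU.sum_comp_eq hV fun x => f x * g x
  simp only [diagDefect, diagAverage, Matrix.diagonal_apply_eq, Function.comp_apply, hsum,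
    hU.conjBy_diagonal_comp_eq hV]

theorem conjBy_diagonal_apply_self (U : Matrix (Fin p) (Fin p) ℝ) (a : Fin p → ℂ) (j : Fin p) :
    conjBy U (Matrix.diagonal a) j j = ∑ k, ((U j k ^ 2 : ℝ) : ℂ) * a k := by
  rw [conjBy, Matrix.mul_apply]
  refine Finset.sum_congr rfl fun k _ => ?_
  rw [Matrix.mul_diagonal, Matrix.transpose_apply, Matrix.map_apply]
  push_cast
  ring

theorem sum_sq_row_eq_one_of_mem_orthogonalGroup {n R : Type*} [Fintype n] [DecidableEq n]
    [CommRing R] {U : Matrix n n R} (hU : U ∈ Matrix.orthogonalGroup n R) (j : n) :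
    ∑ k, U j k ^ 2 = 1 := by
  have h := congrFun₂ ((Matrix.mem_orthogonalGroup_iff _ _).mp hU) j j
  simpa only [Matrix.mul_apply, Matrix.transpose_apply, ← sq, Matrix.one_apply_eq] using h

theorem sq_diag_le_one_of_mem_orthogonalGroup {n R : Type*} [Fintype n] [DecidableEq n]
    [CommRing R] [LinearOrder R] [IsStrictOrderedRing R] {U : Matrix n n R}
    (hU : U ∈ Matrix.orthogonalGroup n R) (j : n) : U j j ^ 2 ≤ 1 := by
  rw [← sum_sq_row_eq_one_of_mem_orthogonalGroup hU j]
  exact Finset.single_le_sum (f := fun k => U j k ^ 2) (fun k _ => sq_nonneg _)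
    (Finset.mem_univ j)

variable {U : Matrix (Fin p) (Fin p) ℝ} {a b : Fin p → ℂ} {K L : ℝ}

theorem norm_conjBy_diagonal_apply_self_le (hU : U ∈ Matrix.orthogonalGroup (Fin p) ℝ)
    (ha : ∀ k, ‖a k‖ ≤ K) (j : Fin p) : ‖conjBy U (Matrix.diagonal a) j j‖ ≤ K := by
  rw [conjBy_diagonal_apply_self]
  calc ‖∑ k, ((U j k ^ 2 : ℝ) : ℂ) * a k‖ ≤ ∑ k, U j k ^ 2 * K := by
        refine norm_sum_le_of_le _ fun k _ => ?_
        rw [norm_mul, Complex.norm_real, Real.norm_of_nonneg (sq_nonneg _)]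
        exact mul_le_mul_of_nonneg_left (ha k) (sq_nonneg _)
    _ = K := by rw [← Finset.sum_mul, sum_sq_row_eq_one_of_mem_orthogonalGroup hU, one_mul]

theorem norm_conjBy_diagonal_apply_self_sub_le (hU : U ∈ Matrix.orthogonalGroup (Fin p) ℝ)
    (ha : ∀ k, ‖a k‖ ≤ K) (j : Fin p) :
    ‖conjBy U (Matrix.diagonal a) j j - a j‖ ≤ 2 * K * (1 - U j j ^ 2) := by
  have hrow := sum_sq_row_eq_one_of_mem_orthogonalGroup hU j
  have hoff : ∑ k ∈ Finset.univ.erase j, U j k ^ 2 = 1 - U j j ^ 2 := by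
    rw [← hrow, ← Finset.sum_erase_add _ _ (Finset.mem_univ j), add_sub_cancel_right]
  have hsum : conjBy U (Matrix.diagonal a) j j - a j =
      ∑ k ∈ Finset.univ.erase j, ((U j k ^ 2 : ℝ) : ℂ) * (a k - a j) := by
    have hweights : ∑ k, ((U j k ^ 2 : ℝ) : ℂ) * a j = a j := by
      rw [← Finset.sum_mul, ← Complex.ofReal_sum, hrow, Complex.ofReal_one, one_mul]
    rw [Finset.sum_erase _ (by rw [sub_self, mul_zero]), conjBy_diagonal_apply_self]
    simp only [mul_sub, Finset.sum_sub_distrib, hweights]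
  rw [hsum, ← hoff, Finset.mul_sum]
  refine norm_sum_le_of_le _ fun k _ => ?_
  have hdiff : ‖a k - a j‖ ≤ 2 * K := by linarith [norm_sub_le (a k) (a j), ha k, ha j]
  rw [norm_mul, Complex.norm_real, Real.norm_of_nonneg (sq_nonneg _), mul_comm]
  exact mul_le_mul_of_nonneg_right hdiff (sq_nonneg _)

theorem norm_conjBy_diagonal_mul_sub_le (hU : U ∈ Matrix.orthogonalGroup (Fin p) ℝ)
    (ha : ∀ k, ‖a k‖ ≤ K) (hb : ∀ k, ‖b k‖ ≤ L) (j : Fin p) :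
    ‖conjBy U (Matrix.diagonal a) j j * conjBy U (Matrix.diagonal b) j j - a j * b j‖ ≤
      4 * K * L * (1 - U j j ^ 2) := by
  have hK : 0 ≤ K := (norm_nonneg _).trans (ha j)
  have hasub := norm_conjBy_diagonal_apply_self_sub_le hU ha j
  have hbsub := norm_conjBy_diagonal_apply_self_sub_le hU hb j
  have hb' := norm_conjBy_diagonal_apply_self_le hU hb j
  set α := conjBy U (Matrix.diagonal a) j j
  set β := conjBy U (Matrix.diagonal b) j j
  calc ‖α * β - a j * b j‖ = ‖(α - a j) * β + a j * (β - b j)‖ := by ring_nf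
    _ ≤ ‖α - a j‖ * ‖β‖ + ‖a j‖ * ‖β - b j‖ := by
      simpa only [norm_mul] using norm_add_le ((α - a j) * β) (a j * (β - b j))
    _ ≤ 2 * K * (1 - U j j ^ 2) * L + K * (2 * L * (1 - U j j ^ 2)) := by
      have := (norm_nonneg _).trans hasub
      gcongr
      exact ha j
    _ = 4 * K * L * (1 - U j j ^ 2) := by ring

theorem norm_diagDefect_diagonal_le (hU : U ∈ Matrix.orthogonalGroup (Fin p) ℝ)
    (ha : ∀ k, ‖a k‖ ≤ K) (hb : ∀ k, ‖b k‖ ≤ L) :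
    ‖diagDefect U (Matrix.diagonal a) (Matrix.diagonal b)‖ ≤
      4 * K * L * ((∑ j, (1 - U j j ^ 2)) / p) := by
  rw [diagDefect, diagAverage, diagAverage, ← mul_sub, ← Finset.sum_sub_distrib, norm_mul, norm_inv,
    Complex.norm_natCast, mul_div_assoc', div_eq_inv_mul, Finset.mul_sum]
  gcongr
  refine norm_sum_le_of_le _ fun j _ => ?_
  rw [Matrix.diagonal_apply_eq, Matrix.diagonal_apply_eq]
  exact norm_conjBy_diagonal_mul_sub_le hU ha hb j

end DiagonalDefect

section Reflection

theorem one_sub_two_smul_mem_orthogonalGroup {n R : Type*} [Fintype n] [DecidableEq n] [CommRing R]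
    {P : Matrix n n R} (hsymm : P.IsSymm) (hidem : P * P = P) :
    1 - 2 • P ∈ Matrix.orthogonalGroup n R := by
  rw [Matrix.mem_orthogonalGroup_iff, Matrix.transpose_sub, Matrix.transpose_smul, hsymm.eq,
    Matrix.transpose_one, sub_mul, mul_sub, mul_sub, smul_mul_smul_comm, hidem, one_mul, mul_one,
    one_mul]
  module

theorem trace_eq_rank_of_mul_self {n k : Type*} [Fintype n] [Field k] {P : Matrix n n k}
    (hidem : P * P = P) : P.trace = P.rank := by
  classical
  have hlin : IsIdempotentElem (Matrix.toLin' P) := by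
    rw [IsIdempotentElem, Module.End.mul_eq_comp, ← Matrix.toLin'_mul, hidem]
  rw [← Matrix.trace_toLin'_eq, (LinearMap.IsIdempotentElem.isProj_range _ hlin).trace]
  rfl

theorem sum_one_sub_sq_diag_one_sub_two_smul_le {n : Type*} [Fintype n] [DecidableEq n]
    {P : Matrix n n ℝ} (hidem : P * P = P) :
    ∑ j, (1 - (1 - 2 • P : Matrix n n ℝ) j j ^ 2) ≤ 4 * (P.rank : ℝ) := by
  rw [← trace_eq_rank_of_mul_self hidem, Matrix.trace, Finset.mul_sum]
  refine Finset.sum_le_sum fun j _ => ?_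
  rw [Matrix.sub_apply, Matrix.one_apply_eq, Matrix.smul_apply, Matrix.diag_apply, nsmul_eq_mul]
  push_cast
  nlinarith [sq_nonneg (P j j)]

theorem sum_one_sub_sq_diag_one_sub_two_smul_isBigO_rank {p : ℕ → ℕ}
    {P : ∀ n, Matrix (Fin (p n)) (Fin (p n)) ℝ} (hsymm : ∀ n, (P n).IsSymm)
    (hidem : ∀ n, P n * P n = P n) :
    (fun n => ∑ j, (1 - (1 - 2 • P n : Matrix (Fin (p n)) (Fin (p n)) ℝ) j j ^ 2)) =O[atTop]
      (fun n => ((P n).rank : ℝ)) := by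
  refine .of_bound 4 (Eventually.of_forall fun n => ?_)
  have hU := one_sub_two_smul_mem_orthogonalGroup (hsymm n) (hidem n)
  rw [Real.norm_natCast, Real.norm_of_nonneg (Finset.sum_nonneg fun j _ =>
    sub_nonneg.mpr (sq_diag_le_one_of_mem_orthogonalGroup hU j))]
  exact sum_one_sub_sq_diag_one_sub_two_smul_le (hidem n)

end Reflection

theorem proposition4p2_general (p : ℕ → ℕ)
    (U : ∀ n, Matrix (Fin (p n)) (Fin (p n)) ℝ)
    (hU : ∀ n, U n ∈ Matrix.orthogonalGroup (Fin (p n)) ℝ)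
    (hdiag : (fun n => ∑ j, (1 - U n j j ^ 2)) =o[atTop] (fun n => (p n : ℝ)))
    (lam : ∀ n, Fin (p n) → ℝ)
    (hnonneg : ∀ n i, 0 ≤ lam n i)
    (hbdd : ∃ C : ℝ, ∀ᶠ n in atTop, ∀ i, lam n i ≤ C) :
    EigenvectorRegularity p (fun n => U n * Matrix.diagonal (lam n) * (U n)ᵀ) := by
  intro V mu hV
  refine ⟨fun n z hz => isUnit_middleFactor (mu n) hz, fun z₁ z₂ hz₁ hz₂ l _ => ?_⟩
  have hUlam : ∀ n, IsSpectralDecomposition _ (U n) (lam n) := fun n => ⟨hU n, rfl⟩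
  have hmu : ∀ n j, 0 ≤ mu n j := fun n j => by
    obtain ⟨i, hi⟩ := (hV n).exists_eigenvalue_eq (hUlam n) j
    exact hi ▸ hnonneg n i
  obtain ⟨C, hC⟩ := hbdd
  set bound : ℕ → ℂ → ℝ := fun l z => C / (z.im ^ 2 / (C + |z.im|)) ^ l
  have hlim := hdiag.tendsto_div_nhds_zero.const_mul (4 * bound l z₁ * bound 2 z₂)
  rw [mul_zero] at hlim
  refine squeeze_zero_norm' ?_ hlim
  filter_upwards [hC] with n hn
  have hsymbol : ∀ l z, z.im ≠ 0 → ∀ i,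
      ‖gammaSymbol (spectralDistribution (mu n)) (p n / n) l z (lam n i)‖ ≤ bound l z := by
    intro l z hz i
    have := isProbabilityMeasure_spectralDistribution i.pos.ne' (mu n)
    exact norm_gammaSymbol_le (by positivity) l hz ((abs_of_nonneg (hnonneg n i)).trans_le (hn i))
  rw [← diagDefect, gammaMatrix_eq_diagonal (hmu n) l hz₁, gammaMatrix_eq_diagonal (hmu n) 2 hz₂,
    (hV n).diagDefect_diagonal_comp_eq (hUlam n)]
  exact norm_diagDefect_diagonal_le (hU n) (hsymbol l z₁ hz₁) (hsymbol 2 z₂ hz₂)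

theorem proposition4p2 (p : ℕ → ℕ)
    (P : ∀ n, Matrix (Fin (p n)) (Fin (p n)) ℝ)
    (hsymm : ∀ n, (P n).IsSymm)
    (hidem : ∀ n, P n * P n = P n)
    (hrank : (fun n => ((P n).rank : ℝ)) =o[Filter.atTop] (fun n => (p n : ℝ)))
    (lam : ∀ n, Fin (p n) → ℝ)
    (hnonneg : ∀ n i, 0 ≤ lam n i)
    (hbdd : ∃ C : ℝ, ∀ᶠ n in Filter.atTop, ∀ i, lam n i ≤ C) :
    EigenvectorRegularity p
      (fun n => (1 - 2 • P n) * Matrix.diagonal (lam n) * (1 - 2 • P n)ᵀ) := by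
  exact proposition4p2_general p _
    (fun n => one_sub_two_smul_mem_orthogonalGroup (hsymm n) (hidem n))
    ((sum_one_sub_sq_diag_one_sub_two_smul_isBigO_rank hsymm hidem).trans_isLittleO hrank)
    lam hnonneg hbdd
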